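/- Let $\Omega(n)$ be the number of prime factors of $n$ counted with multiplicity. Let $\log_0 x=x$ and $\log_{i+1}x=\log_i(\log x)$ (defined for $x$ large enough), and let $\log_0^+x=x$ and $\log_{i+1}^+x=\log^+(\log_i^+x)$, where $\log^+x=\max\{\log|x|,0\}$ and $\log^+0=0$. An arithmetic function $f$ is said to have average order $g$ if $\frac1X\sum_{1\le n\le X}f(n)\asymp g(X)$ as $X\to\infty$. Then for every integer $j\ge 0$ and every real $\alpha>0$: (1) as $X\to\infty$, with an implied constant depending only on $j$ and $\alpha$, \[ \sum_{1\le n\le X}\bigl(\log_j^+\Omega(n)\bigr)^\alpha = X(\log_{j+2}X)^\alpha+O\!\left(\frac{X(\log_{j+2}X)^\alpha}{\log_2X}\right); \] (2) the function $(\log_j^+\Omega(n))^\alpha$ has average order $(\log_{j+2}^+n)^\alpha$; (3) the weight $w_n=(1+\log_j^+\Omega(n))^\alpha$ also has average order $(\log_{j+2}^+n)^\alpha$. (This is the weight of the Hilbert space $\mathscr H_{\log,j}$ of Dirichlet series $\sum_{n\ge1}a_nn^{-s}$ with $\sum_{n\ge 1}|a_n|^2/w_n<\infty$.) -/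

import Mathlib

open Filter Asymptotics

noncomputable section

/-- The `j`-fold logarithm: `log_0 x = x` and `log_{j+1} x = log_j (log x)`. -/
def iterLog (j : ℕ) (x : ℝ) : ℝ := Real.log^[j] x

/-- The `j`-fold positive logarithm: `log_0^+ x = x` and `log_{j+1}^+ x = log^+ (log_j^+ x)`,
where `log^+ x = max {log |x|, 0}`. -/
def iterPosLog : ℕ → ℝ → ℝ
  | 0, x => x
  | j + 1, x => Real.posLog (iterPosLog j x)

/-- The summatory function `∑_{1 ≤ n ≤ X} f n` of an arithmetic function, for real `X`. -/
def summatory (f : ℕ → ℝ) (X : ℝ) : ℝ := ∑ n ∈ Finset.Icc 1 ⌊X⌋₊, f n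

/-- `f` has average order `g`: `(1 / X) ∑_{n ≤ X} f n ≍ g X` as `X → ∞`. -/
def HasAverageOrder (f : ℕ → ℝ) (g : ℝ → ℝ) : Prop :=
  (fun X : ℝ => 1 / X * summatory f X) =Θ[atTop] g

/-- The arithmetic function `n ↦ log_j^+ Ω(n)`, with `Ω` the number of prime factors counted
with multiplicity. -/
def iterPosLogOmega (j n : ℕ) : ℝ := iterPosLog j (ArithmeticFunction.cardFactors n : ℝ)

/-- The weight `w_n = (1 + log_j^+ Ω(n))^α` of the Hilbert space of Dirichlet series
`∑ a_n n^{-s}` with `∑ |a_n|^2 / w_n < ∞` into which composition operators map. -/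
def logWeight (j : ℕ) (α : ℝ) (n : ℕ) : ℝ := (1 + iterPosLogOmega j n) ^ α

end

/-! Let `L = log log X`. The function `t ↦ log_j^+ (L t) / log_j^+ L` takes the value `1` at
`t = 1` and lies between some line of slope in `[0, 1]` through that point and the same line minus
`K (t - 1) ^ 2`, with `K` independent of `L`, because this property survives composition with one
more normalized `log^+`. Taking `α`-th powers, and an integer `m ≥ α`, the mean over `n ≤ X` of
`(log_j^+ Ω(n) / log_j^+ L) ^ α` differs from `1` by at most a multiple of the corresponding
deviations of the moments of order `0`, `1`, `2` and `m` of `Ω(n) / L`. Expanding one factor of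
`Ω(n) ^ k` as a sum over the prime powers dividing `n` bounds the moments of `Ω` recursively in
terms of `∑_{p ≤ X} 1 / p`, which is `L + O(1)` by Mertens, so these deviations are `O(1 / L)`.
-/

open Finset Real
open scoped ArithmeticFunction.Omega

/-! ### Mertens' estimate for the sum of the reciprocals of the primes -/

theorem hasSum_smoothNumbers_rpow_neg {s : ℝ} (hs : 0 < s) (N : ℕ) :
    HasSum (fun m : (N + 1).smoothNumbers => (m : ℝ) ^ (-s))
      (exp (∑ p ∈ N.primesLE, -log (1 - (p : ℝ) ^ (-s)))) := by
  let f : ℕ →* ℝ :=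
    { toFun := fun n => (n : ℝ) ^ (-s)
      map_one' := by simp
      map_mul' := fun m n => by
        rw [Nat.cast_mul, mul_rpow (Nat.cast_nonneg m) (Nat.cast_nonneg n)] }
  have f_lt_one {p : ℕ} (hp : p.Prime) : f p < 1 :=
    rpow_lt_one_of_one_lt_of_neg (mod_cast hp.one_lt) (neg_neg_of_pos hs)
  have euler_product := (EulerProduct.summable_and_hasSum_smoothNumbers_prod_primesBelow_geometric
    (f := f) (fun hp => by
      rw [norm_of_nonneg (show 0 ≤ f _ from rpow_nonneg (Nat.cast_nonneg _) _)]
      exact f_lt_one hp) (N + 1)).2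
  have exp_eq_prod : exp (∑ p ∈ N.primesLE, -log (1 - (p : ℝ) ^ (-s)))
      = ∏ p ∈ (N + 1).primesBelow, (1 - f p)⁻¹ := by
    rw [exp_sum]
    refine prod_congr rfl fun p hp => ?_
    have one_sub_pos : 0 < 1 - (p : ℝ) ^ (-s) :=
      sub_pos.mpr (f_lt_one (Nat.prime_of_mem_primesLE hp))
    rw [exp_neg, exp_log one_sub_pos]
    rfl
  rw [exp_eq_prod]
  exact euler_product

theorem tsum_rpow_neg_one_add_le {δ : ℝ} (hδ : 0 < δ) :
    ∑' n : ℕ, (n : ℝ) ^ (-(1 + δ)) ≤ 1 + δ⁻¹ := by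
  have summable : Summable fun n : ℕ => (n : ℝ) ^ (-(1 + δ)) :=
    summable_nat_rpow.mpr (by linarith)
  have zeta_eq := ZetaAsymptotics.zeta_limit_aux1 (s := 1 + δ) (by linarith)
  have remainder_nonneg : 0 ≤ ZetaAsymptotics.termTSum (1 + δ) :=
    tsum_nonneg fun n => ZetaAsymptotics.term_nonneg (n + 1) _
  rw [summable.tsum_eq_zero_add, Nat.cast_zero, zero_rpow (by linarith), zero_add]
  simp only [one_div, add_sub_cancel_left] at zeta_eq
  simp only [Nat.cast_add, Nat.cast_one]
  have rpow_neg_eq (n : ℕ) : ((n : ℝ) + 1) ^ (-(1 + δ)) = (((n : ℝ) + 1) ^ (1 + δ))⁻¹ :=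
    rpow_neg (by positivity) _
  simp only [rpow_neg_eq]
  nlinarith

theorem sum_primesLE_rpow_neg_one_add_le {δ : ℝ} (hδ : 0 < δ) (N : ℕ) :
    ∑ p ∈ N.primesLE, (p : ℝ) ^ (-(1 + δ)) ≤ log (1 + δ⁻¹) := by
  have hs : 0 < 1 + δ := by linarith
  have euler_product := hasSum_smoothNumbers_rpow_neg hs N
  rw [le_log_iff_exp_le (by positivity)]
  calc exp (∑ p ∈ N.primesLE, (p : ℝ) ^ (-(1 + δ)))
      ≤ exp (∑ p ∈ N.primesLE, -log (1 - (p : ℝ) ^ (-(1 + δ)))) := by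
        gcongr with p hp
        have := log_le_sub_one_of_pos (sub_pos.mpr (rpow_lt_one_of_one_lt_of_neg
          (mod_cast Nat.one_lt_of_mem_primesLE hp : (1 : ℝ) < p) (neg_neg_of_pos hs)))
        linarith
    _ = ∑' m : (N + 1).smoothNumbers, (m : ℝ) ^ (-(1 + δ)) := euler_product.tsum_eq.symm
    _ ≤ ∑' n : ℕ, (n : ℝ) ^ (-(1 + δ)) :=
        (summable_nat_rpow.mpr (by linarith)).tsum_subtype_le _ _ fun n => by positivity
    _ ≤ 1 + δ⁻¹ := tsum_rpow_neg_one_add_le hδ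

theorem log_add_one_le_exp_sum_primesLE (N : ℕ) :
    log (N + 1) ≤ exp (∑ p ∈ N.primesLE, -log (1 - (p : ℝ)⁻¹)) := by
  have euler_product := hasSum_smoothNumbers_rpow_neg one_pos N
  simp only [rpow_neg_one] at euler_product
  have smooth {n : ℕ} (hn : n ∈ Icc 1 N) : n ∈ (N + 1).smoothNumbers :=
    Nat.mem_smoothNumbers_of_lt (mem_Icc.mp hn).1 (Nat.lt_succ_of_le (mem_Icc.mp hn).2)
  calc log (N + 1) ≤ harmonic N := mod_cast log_add_one_le_harmonic N
    _ = ∑ n ∈ Icc 1 N, (n : ℝ)⁻¹ := by rw [harmonic_eq_sum_Icc]; push_cast; rfl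
    _ = ∑ m ∈ (Icc 1 N).subtype (· ∈ (N + 1).smoothNumbers), (m : ℝ)⁻¹ :=
        (sum_subtype_of_mem _ fun _ => smooth).symm
    _ ≤ _ := sum_le_hasSum _ (fun _ _ => by positivity) euler_product

theorem neg_log_one_sub_le {x : ℝ} (hx : x ≤ 1 / 2) : -log (1 - x) ≤ x + 2 * x ^ 2 := by
  have one_sub_pos : 0 < 1 - x := by linarith
  have inv_le : (1 - x)⁻¹ ≤ 1 + x + 2 * x ^ 2 := by
    rw [inv_le_iff_one_le_mul₀ one_sub_pos]
    nlinarith [mul_nonneg (sq_nonneg x) (by linarith : 0 ≤ 1 - 2 * x)]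
  linarith [one_sub_inv_le_log_of_pos one_sub_pos]

theorem sum_log_mul_div_primesLE_le (N : ℕ) :
    ∑ p ∈ N.primesLE, log p * ((N / p : ℕ) : ℝ) ≤ N * log N := by
  have sum_vonMangoldt_le : ∑ n ∈ Ioc 0 N, ArithmeticFunction.vonMangoldt n * ((N / n : ℕ) : ℝ)
      ≤ N * log N := by
    calc ∑ n ∈ Ioc 0 N, ArithmeticFunction.vonMangoldt n * ((N / n : ℕ) : ℝ)
        = ∑ n ∈ Ioc 0 N, log n := by
          rw [← ArithmeticFunction.sum_Ioc_mul_zeta_eq_sum]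
          simp only [ArithmeticFunction.vonMangoldt_mul_zeta, ArithmeticFunction.log_apply]
      _ ≤ #(Ioc 0 N) • log N := by
          refine sum_le_card_nsmul _ _ _ fun n hn => ?_
          rw [mem_Ioc] at hn
          exact log_le_log (mod_cast hn.1) (mod_cast hn.2)
      _ = N * log N := by simp
  refine le_trans ?_ sum_vonMangoldt_le
  rw [Nat.primesLE_eq_filter_Ioc_zero, sum_filter]
  refine sum_le_sum fun n _ => ?_
  split_ifs with hp
  · rw [ArithmeticFunction.vonMangoldt_apply_prime hp]
  · exact mul_nonneg ArithmeticFunction.vonMangoldt_nonneg (Nat.cast_nonneg _)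

theorem sum_log_div_primesLE_le {N : ℕ} (hN : 1 ≤ N) :
    ∑ p ∈ N.primesLE, log p / p ≤ log N + log 4 := by
  have hN0 : (0 : ℝ) < N := mod_cast hN
  have theta_le : ∑ p ∈ N.primesLE, log p ≤ log 4 * N := by
    rw [← Chebyshev.theta_eq_sum_primesLE_log]
    exact Chebyshev.theta_le_log4_mul_x hN0.le
  refine le_of_mul_le_mul_left ?_ hN0
  calc N * ∑ p ∈ N.primesLE, log p / p
      = ∑ p ∈ N.primesLE, log p * ((N : ℝ) / p) := by
        rw [mul_sum]; exact sum_congr rfl fun p _ => by ring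
    _ ≤ ∑ p ∈ N.primesLE, log p * (((N / p : ℕ) : ℝ) + 1) := by
        gcongr with p
        rw [← Nat.floor_div_eq_div (K := ℝ)]
        exact (Nat.lt_floor_add_one _).le
    _ = ∑ p ∈ N.primesLE, log p * ((N / p : ℕ) : ℝ) + ∑ p ∈ N.primesLE, log p := by
        rw [← sum_add_distrib]; exact sum_congr rfl fun p _ => by ring
    _ ≤ N * (log N + log 4) := by linarith [sum_log_mul_div_primesLE_le N]

/-- The sum `∑_{p ≤ N} 1 / p` over the primes. It is the mean of `Ω` over `1, …, N` up to a bounded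
error, and the estimates below are stated in terms of it. -/
noncomputable def primeRecipSum (N : ℕ) : ℝ := ∑ p ∈ N.primesLE, (p : ℝ)⁻¹

theorem primeRecipSum_nonneg (N : ℕ) : 0 ≤ primeRecipSum N :=
  sum_nonneg fun _ _ => by positivity

theorem primeRecipSum_mono : Monotone primeRecipSum := fun _ _ h =>
  sum_le_sum_of_subset_of_nonneg (Nat.primesLE_mono h) fun _ _ _ => by positivity

theorem exists_sum_primesLE_inv_sq_le :
    ∃ C : ℝ, 0 ≤ C ∧ ∀ N : ℕ, ∑ p ∈ N.primesLE, ((p : ℝ) ^ 2)⁻¹ ≤ C :=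
  ⟨∑' n : ℕ, ((n : ℝ) ^ 2)⁻¹, tsum_nonneg fun n => by positivity, fun _ =>
    (summable_nat_pow_inv.mpr one_lt_two).sum_le_tsum _ fun _ _ => by positivity⟩

theorem exists_log_log_le_primeRecipSum_add :
    ∃ C : ℝ, ∀ N : ℕ, 1 ≤ N → log (log (N + 1)) ≤ primeRecipSum N + C := by
  obtain ⟨C, -, hC⟩ := exists_sum_primesLE_inv_sq_le
  refine ⟨2 * C, fun N hN => ?_⟩
  have log_pos : 0 < log ((N : ℝ) + 1) := log_pos (by norm_cast; lia)
  calc log (log (N + 1)) ≤ ∑ p ∈ N.primesLE, -log (1 - (p : ℝ)⁻¹) :=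
        (log_le_iff_le_exp log_pos).mpr (log_add_one_le_exp_sum_primesLE N)
    _ ≤ ∑ p ∈ N.primesLE, ((p : ℝ)⁻¹ + 2 * ((p : ℝ)⁻¹) ^ 2) := by
        refine sum_le_sum fun p hp => neg_log_one_sub_le ?_
        rw [one_div]
        exact inv_anti₀ two_pos (mod_cast Nat.two_le_of_mem_primesLE hp)
    _ = primeRecipSum N + 2 * ∑ p ∈ N.primesLE, ((p : ℝ) ^ 2)⁻¹ := by
        simp only [inv_pow, sum_add_distrib, mul_sum, primeRecipSum]
    _ ≤ primeRecipSum N + 2 * C := by gcongr; exact hC N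

theorem inv_le_rpow_neg_one_add_add {x : ℝ} (hx : 0 < x) (δ : ℝ) :
    x⁻¹ ≤ x ^ (-(1 + δ)) + δ * (log x / x) := by
  have one_sub_le : 1 - δ * log x ≤ x ^ (-δ) := by
    rw [rpow_def_of_pos hx]
    linarith [add_one_le_exp (log x * -δ)]
  have rpow_eq : x ^ (-(1 + δ)) = x⁻¹ * x ^ (-δ) := by
    rw [← rpow_neg_one, ← rpow_add hx, neg_add]
  rw [rpow_eq]
  calc x⁻¹ = x⁻¹ * (1 - δ * log x) + δ * (log x / x) := by ring
    _ ≤ _ := by gcongr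

/- Rankin's trick: comparing `1 / p` with `p ^ (-(1 + δ))` for `δ = 1 / log N` costs only a bounded
error, and the Euler product of `ζ (1 + δ)` bounds the sum of the latter over all primes. -/
theorem primeRecipSum_le_log_log_add {N : ℕ} (hN : 3 ≤ N) :
    primeRecipSum N ≤ log (log N) + (log 2 + 1 + log 4) := by
  have one_le_log : 1 ≤ log N := by
    rw [le_log_iff_exp_le (by positivity)]
    exact exp_one_lt_three.le.trans (mod_cast hN)
  have log_pos : 0 < log N := by linarith
  set δ := (log N)⁻¹ with hδ
  have hδ0 : 0 < δ := inv_pos.mpr log_pos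
  have log_one_add_le : log (1 + δ⁻¹) ≤ log 2 + log (log N) := by
    rw [← log_mul two_ne_zero log_pos.ne', hδ, inv_inv]
    exact log_le_log (by linarith) (by linarith)
  calc primeRecipSum N ≤ ∑ p ∈ N.primesLE, ((p : ℝ) ^ (-(1 + δ)) + δ * (log p / p)) :=
        sum_le_sum fun p hp =>
          inv_le_rpow_neg_one_add_add (mod_cast (Nat.prime_of_mem_primesLE hp).pos) δ
    _ = ∑ p ∈ N.primesLE, (p : ℝ) ^ (-(1 + δ)) + δ * ∑ p ∈ N.primesLE, log p / p := by
        rw [sum_add_distrib, mul_sum]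
    _ ≤ log (1 + δ⁻¹) + δ * (log N + log 4) := by
        gcongr
        · exact sum_primesLE_rpow_neg_one_add_le hδ0 N
        · exact sum_log_div_primesLE_le (by lia)
    _ ≤ log 2 + log (log N) + (1 + log 4) := by
        gcongr
        rw [mul_add, hδ, inv_mul_cancel₀ log_pos.ne']
        gcongr
        exact mul_le_of_le_one_left (by positivity) (inv_le_one_of_one_le₀ one_le_log)
    _ = _ := by ring

theorem tendsto_log_log_atTop : Tendsto (fun X : ℝ => log (log X)) atTop atTop :=
  tendsto_log_atTop.comp tendsto_log_atTop

theorem isBigO_primeRecipSum_floor_sub_log_log :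
    (fun X : ℝ => primeRecipSum ⌊X⌋₊ - log (log X)) =O[atTop] fun _ => (1 : ℝ) := by
  obtain ⟨C, hC⟩ := exists_log_log_le_primeRecipSum_add
  refine .of_bound (max C (log 2 + 1 + log 4)) ?_
  filter_upwards [eventually_ge_atTop 3] with X hX
  have floor_ge : 3 ≤ ⌊X⌋₊ := Nat.le_floor hX
  have one_lt_floor : (1 : ℝ) < ⌊X⌋₊ := mod_cast (by lia : 1 < ⌊X⌋₊)
  have upper : primeRecipSum ⌊X⌋₊ ≤ log (log X) + (log 2 + 1 + log 4) := by
    refine (primeRecipSum_le_log_log_add floor_ge).trans ?_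
    gcongr
    · exact log_pos one_lt_floor
    · exact Nat.floor_le (by linarith)
  have lower : log (log X) ≤ primeRecipSum ⌊X⌋₊ + C := by
    refine le_trans ?_ (hC ⌊X⌋₊ (by lia))
    gcongr
    · exact log_pos (by linarith)
    · exact (Nat.lt_floor_add_one X).le
  rw [norm_one, mul_one, norm_eq_abs, abs_le]
  constructor <;> grind

/-! ### Moments of `Ω` -/

theorem cardFactors_eq_sum_prime_pow_dvd {n N : ℕ} (hn : n ≠ 0) (hnN : n ≤ N) :
    Ω n = ∑ p ∈ N.primesLE, ∑ a ∈ Icc 1 N, if p ^ a ∣ n then 1 else 0 := by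
  have support_subset : n.factorization.support ⊆ N.primesLE := fun p hp => by
    rw [Nat.support_factorization] at hp
    exact Nat.mem_primesLE.mpr
      ⟨(Nat.le_of_mem_primeFactors hp).trans hnN, Nat.prime_of_mem_primeFactors hp⟩
  rw [ArithmeticFunction.cardFactors_eq_sum_factorization,
    Finsupp.sum_of_support_subset _ support_subset _ fun _ _ => rfl]
  refine sum_congr rfl fun p hp => ?_
  have hp := Nat.prime_of_mem_primesLE hp
  rw [Nat.factorization_eq_card_pow_dvd n hp, Nat.Ico_filter_pow_dvd_eq hp hn
    (hnN.trans (Nat.lt_pow_self hp.one_lt).le), sum_boole, Nat.cast_id]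

theorem sum_Icc_ite_dvd {M : Type*} [AddCommMonoid M] (F : ℕ → M) {d : ℕ} (hd : 0 < d) (N : ℕ) :
    (∑ n ∈ Icc 1 N, if d ∣ n then F n else 0) = ∑ m ∈ Icc 1 (N / d), F (d * m) := by
  rw [← sum_filter]
  symm
  refine sum_nbij (d * ·) ?_ ?_ ?_ fun _ _ => rfl
  · intro m hm
    rw [mem_Icc, Nat.le_div_iff_mul_le hd, mul_comm] at hm
    rw [mem_filter, mem_Icc]
    exact ⟨⟨Nat.mul_pos hd hm.1, hm.2⟩, dvd_mul_right _ _⟩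
  · exact fun a _ b _ h => Nat.eq_of_mul_eq_mul_left hd h
  · intro n hn
    rw [mem_coe, mem_filter, mem_Icc] at hn
    obtain ⟨hn, m, rfl⟩ := hn
    refine ⟨m, ?_, rfl⟩
    rw [mem_coe, mem_Icc, Nat.le_div_iff_mul_le hd, mul_comm]
    exact ⟨Nat.pos_of_mul_pos_left hn.1, hn.2⟩

theorem sum_cardFactors_mul {R : Type*} [NonAssocSemiring R] (F : ℕ → R) (N : ℕ) :
    ∑ n ∈ Icc 1 N, (Ω n : R) * F n
      = ∑ p ∈ N.primesLE, ∑ a ∈ Icc 1 N, ∑ m ∈ Icc 1 (N / p ^ a), F (p ^ a * m) := by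
  calc ∑ n ∈ Icc 1 N, (Ω n : R) * F n
      = ∑ n ∈ Icc 1 N, ∑ p ∈ N.primesLE, ∑ a ∈ Icc 1 N, if p ^ a ∣ n then F n else 0 := by
        refine sum_congr rfl fun n hn => ?_
        rw [mem_Icc] at hn
        rw [cardFactors_eq_sum_prime_pow_dvd (by lia) hn.2]
        simp only [Nat.cast_sum, Nat.cast_ite, Nat.cast_one, Nat.cast_zero, sum_mul, ite_mul,
          one_mul, zero_mul]
    _ = _ := by
        rw [sum_comm]
        refine sum_congr rfl fun p hp => ?_
        rw [sum_comm]
        exact sum_congr rfl fun a _ =>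
          sum_Icc_ite_dvd F (pow_pos (Nat.prime_of_mem_primesLE hp).pos a) N

theorem exists_sum_pow_div_pow_le (k : ℕ) :
    ∃ D : ℝ, 0 ≤ D ∧ ∀ x : ℝ, 2 ≤ x → ∀ N : ℕ,
      ∑ a ∈ Icc 1 N, (a : ℝ) ^ k / x ^ a ≤ x⁻¹ + D * (x ^ 2)⁻¹ := by
  have summable : Summable fun a : ℕ => ((a + 2 : ℕ) : ℝ) ^ k * (1 / 2 : ℝ) ^ (a + 2) :=
    (summable_nat_add_iff (f := fun a : ℕ => (a : ℝ) ^ k * (1 / 2 : ℝ) ^ a) 2).mpr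
      (summable_pow_mul_geometric_of_norm_lt_one k (by norm_num))
  refine ⟨4 * ∑' a : ℕ, ((a + 2 : ℕ) : ℝ) ^ k * (1 / 2 : ℝ) ^ (a + 2),
    by positivity, fun x hx N => ?_⟩
  have term_le (a : ℕ) : ((a + 2 : ℕ) : ℝ) ^ k / x ^ (a + 2)
      ≤ (x ^ 2)⁻¹ * (4 * (((a + 2 : ℕ) : ℝ) ^ k * (1 / 2 : ℝ) ^ (a + 2))) := by
    calc ((a + 2 : ℕ) : ℝ) ^ k / x ^ (a + 2)
        = (x ^ 2)⁻¹ * (((a + 2 : ℕ) : ℝ) ^ k * (1 / x) ^ a) := by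
          rw [pow_add, one_div, inv_pow]; field_simp
      _ ≤ (x ^ 2)⁻¹ * (((a + 2 : ℕ) : ℝ) ^ k * (1 / 2) ^ a) := by gcongr
      _ = _ := by rw [pow_add (1 / 2 : ℝ)]; ring
  calc ∑ a ∈ Icc 1 N, (a : ℝ) ^ k / x ^ a
      ≤ ∑ a ∈ Ico 1 (N + 2), (a : ℝ) ^ k / x ^ a :=
        sum_le_sum_of_subset_of_nonneg (fun a ha => by rw [mem_Icc] at ha; rw [mem_Ico]; lia)
          fun _ _ _ => by positivity
    _ = x⁻¹ + ∑ a ∈ range N, ((a + 2 : ℕ) : ℝ) ^ k / x ^ (a + 2) := by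
        rw [sum_eq_sum_Ico_succ_bot (by lia), sum_Ico_eq_sum_range]
        simp [add_comm]
    _ ≤ x⁻¹ + (x ^ 2)⁻¹ * (4 * ∑' a : ℕ, ((a + 2 : ℕ) : ℝ) ^ k * (1 / 2 : ℝ) ^ (a + 2)) := by
        gcongr
        refine (sum_le_sum fun a _ => term_le a).trans ?_
        rw [← mul_sum, ← mul_sum]
        gcongr
        exact summable.sum_le_tsum _ fun _ _ => by positivity
    _ = _ := by ring

theorem exists_sum_prime_pow_le_primeRecipSum_add (k : ℕ) :
    ∃ D : ℝ, 0 ≤ D ∧ ∀ N : ℕ,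
      ∑ p ∈ N.primesLE, ∑ a ∈ Icc 1 N, (a : ℝ) ^ k / (p : ℝ) ^ a ≤ primeRecipSum N + D := by
  obtain ⟨C, hC0, hC⟩ := exists_sum_primesLE_inv_sq_le
  obtain ⟨D, hD0, hD⟩ := exists_sum_pow_div_pow_le k
  refine ⟨D * C, by positivity, fun N => ?_⟩
  calc ∑ p ∈ N.primesLE, ∑ a ∈ Icc 1 N, (a : ℝ) ^ k / (p : ℝ) ^ a
      ≤ ∑ p ∈ N.primesLE, ((p : ℝ)⁻¹ + D * ((p : ℝ) ^ 2)⁻¹) :=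
        sum_le_sum fun p hp => hD p (mod_cast Nat.two_le_of_mem_primesLE hp) N
    _ = primeRecipSum N + D * ∑ p ∈ N.primesLE, ((p : ℝ) ^ 2)⁻¹ := by
        rw [sum_add_distrib, mul_sum, primeRecipSum]
    _ ≤ primeRecipSum N + D * C := by gcongr; exact hC N

/- The shift by `b` in the hypothesis `hC` is what makes the induction on `k` close up, as
`Ω (p ^ a * m) + b = Ω m + (a + b)`. -/
theorem sum_cardFactors_prime_pow_mul_add_pow_le {k : ℕ} {C : ℝ} (hC0 : 0 ≤ C)
    (hC : ∀ N b : ℕ, ∑ n ∈ Icc 1 N, ((Ω n : ℝ) + b) ^ k ≤ N * (primeRecipSum N + C + b) ^ k)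
    {p a : ℕ} (hp : p.Prime) (ha : 1 ≤ a) (N b : ℕ) :
    ∑ m ∈ Icc 1 (N / p ^ a), ((Ω (p ^ a * m) : ℝ) + b) ^ k
      ≤ N * (primeRecipSum N + C + b + 1) ^ k * ((a : ℝ) ^ k / (p : ℝ) ^ a) := by
  have one_le : (1 : ℝ) ≤ a := mod_cast ha
  have recip_nonneg := primeRecipSum_nonneg (N / p ^ a)
  have recip_le : primeRecipSum (N / p ^ a) ≤ primeRecipSum N :=
    primeRecipSum_mono (Nat.div_le_self _ _)
  calc ∑ m ∈ Icc 1 (N / p ^ a), ((Ω (p ^ a * m) : ℝ) + b) ^ k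
      = ∑ m ∈ Icc 1 (N / p ^ a), ((Ω m : ℝ) + ((a + b : ℕ) : ℝ)) ^ k := by
        refine sum_congr rfl fun m hm => ?_
        rw [mem_Icc] at hm
        rw [ArithmeticFunction.cardFactors_mul (pow_ne_zero _ hp.ne_zero) (by lia),
          ArithmeticFunction.cardFactors_apply_prime_pow hp]
        push_cast
        ring
    _ ≤ ((N / p ^ a : ℕ) : ℝ) * (primeRecipSum (N / p ^ a) + C + ((a + b : ℕ) : ℝ)) ^ k :=
        hC _ _
    _ ≤ (N / (p : ℝ) ^ a) * ((primeRecipSum N + C + b + 1) * a) ^ k := by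
        gcongr
        · exact mod_cast Nat.cast_div_le (α := ℝ) (m := N) (n := p ^ a)
        · push_cast
          nlinarith [b.cast_nonneg (α := ℝ)]
    _ = _ := by rw [mul_pow]; ring

theorem sum_cardFactors_mul_add_pow_le {k : ℕ} {C D : ℝ} (hC0 : 0 ≤ C)
    (hC : ∀ N b : ℕ, ∑ n ∈ Icc 1 N, ((Ω n : ℝ) + b) ^ k ≤ N * (primeRecipSum N + C + b) ^ k)
    (hD : ∀ N : ℕ,
      ∑ p ∈ N.primesLE, ∑ a ∈ Icc 1 N, (a : ℝ) ^ k / (p : ℝ) ^ a ≤ primeRecipSum N + D)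
    (N b : ℕ) :
    ∑ n ∈ Icc 1 N, (Ω n : ℝ) * ((Ω n : ℝ) + b) ^ k
      ≤ N * (primeRecipSum N + C + b + 1) ^ k * (primeRecipSum N + D) := by
  have recip_nonneg := primeRecipSum_nonneg N
  calc ∑ n ∈ Icc 1 N, (Ω n : ℝ) * ((Ω n : ℝ) + b) ^ k
      = ∑ p ∈ N.primesLE, ∑ a ∈ Icc 1 N, ∑ m ∈ Icc 1 (N / p ^ a), ((Ω (p ^ a * m) : ℝ) + b) ^ k :=
        sum_cardFactors_mul (fun n => ((Ω n : ℝ) + b) ^ k) N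
    _ ≤ ∑ p ∈ N.primesLE, ∑ a ∈ Icc 1 N,
          N * (primeRecipSum N + C + b + 1) ^ k * ((a : ℝ) ^ k / (p : ℝ) ^ a) :=
        sum_le_sum fun p hp => sum_le_sum fun a ha =>
          sum_cardFactors_prime_pow_mul_add_pow_le hC0 hC (Nat.prime_of_mem_primesLE hp)
            (mem_Icc.mp ha).1 N b
    _ = N * (primeRecipSum N + C + b + 1) ^ k
          * ∑ p ∈ N.primesLE, ∑ a ∈ Icc 1 N, (a : ℝ) ^ k / (p : ℝ) ^ a := by
        simp only [mul_sum]
    _ ≤ N * (primeRecipSum N + C + b + 1) ^ k * (primeRecipSum N + D) := by gcongr; exact hD N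

theorem exists_sum_cardFactors_add_pow_le (k : ℕ) :
    ∃ C : ℝ, 0 ≤ C ∧ ∀ N b : ℕ,
      ∑ n ∈ Icc 1 N, ((Ω n : ℝ) + b) ^ k ≤ N * (primeRecipSum N + C + b) ^ k := by
  induction k with
  | zero => exact ⟨0, le_rfl, fun N b => by simp⟩
  | succ k ih =>
    obtain ⟨C, hC0, hC⟩ := ih
    obtain ⟨D, hD0, hD⟩ := exists_sum_prime_pow_le_primeRecipSum_add k
    refine ⟨C + 1 + D, by positivity, fun N b => ?_⟩
    have recip_nonneg := primeRecipSum_nonneg N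
    calc ∑ n ∈ Icc 1 N, ((Ω n : ℝ) + b) ^ (k + 1)
        = ∑ n ∈ Icc 1 N, (Ω n : ℝ) * ((Ω n : ℝ) + b) ^ k
            + b * ∑ n ∈ Icc 1 N, ((Ω n : ℝ) + b) ^ k := by
          rw [mul_sum, ← sum_add_distrib]
          exact sum_congr rfl fun n _ => by ring
      _ ≤ N * (primeRecipSum N + C + b + 1) ^ k * (primeRecipSum N + D)
            + b * (N * (primeRecipSum N + C + b + 1) ^ k) := by
          gcongr ?_ + b * ?_
          · exact sum_cardFactors_mul_add_pow_le hC0 hC hD N b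
          · exact (hC N b).trans (by gcongr _ * ?_ ^ k; linarith)
      _ = N * ((primeRecipSum N + C + b + 1) ^ k * (primeRecipSum N + D + b)) := by ring
      _ ≤ N * ((primeRecipSum N + (C + 1 + D) + b) ^ k
            * (primeRecipSum N + (C + 1 + D) + b)) := by
          gcongr _ * (?_ ^ k * ?_) <;> linarith
      _ = _ := by rw [pow_succ]

theorem mul_primeRecipSum_sub_le_sum_cardFactors (N : ℕ) :
    N * primeRecipSum N - N ≤ ∑ n ∈ Icc 1 N, (Ω n : ℝ) := by
  have card_primesLE_le : (#N.primesLE : ℝ) ≤ N := by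
    rw [Nat.primesLE_eq_filter_Icc_one]
    exact mod_cast (card_filter_le _ _).trans_eq (by simp)
  calc N * primeRecipSum N - N ≤ ∑ p ∈ N.primesLE, ((N : ℝ) / p - 1) := by
        rw [sum_sub_distrib, sum_const, nsmul_one, primeRecipSum, mul_sum]
        simp only [div_eq_mul_inv]
        linarith
    _ ≤ ∑ p ∈ N.primesLE, ∑ a ∈ Icc 1 N, ((N / p ^ a : ℕ) : ℝ) := by
        refine sum_le_sum fun p hp => ?_
        have one_mem : 1 ∈ Icc 1 N := mem_Icc.mpr ⟨le_rfl,
          (Nat.one_lt_of_mem_primesLE hp).le.trans (Nat.le_of_mem_primesLE hp)⟩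
        refine le_trans ?_ (single_le_sum (fun a _ => Nat.cast_nonneg (N / p ^ a)) one_mem)
        rw [pow_one, ← Nat.floor_div_eq_div (K := ℝ)]
        exact (Nat.sub_one_lt_floor _).le
    _ = ∑ n ∈ Icc 1 N, (Ω n : ℝ) := by
        simpa using (sum_cardFactors_mul (fun _ => (1 : ℝ)) N).symm

theorem one_add_mul_sub_one_pow_le {c t : ℝ} (hc0 : 0 ≤ c) (hc1 : c ≤ 1) (ht : 0 ≤ t) (m : ℕ) :
    (1 + c * (t - 1)) ^ m ≤ 1 + c * (t ^ m - 1) := by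
  have convex := (convexOn_pow m).2 (Set.mem_Ici.mpr zero_le_one) (Set.mem_Ici.mpr ht)
    (sub_nonneg.mpr hc1) hc0 (sub_add_cancel 1 c)
  simp only [smul_eq_mul, one_pow, mul_one] at convex
  calc (1 + c * (t - 1)) ^ m = (1 - c + c * t) ^ m := by ring
    _ ≤ 1 - c + c * t ^ m := convex
    _ = 1 + c * (t ^ m - 1) := by ring

theorem exists_summatory_cardFactors_div_pow_le (k : ℕ) :
    ∃ C : ℝ, ∀ᶠ X in atTop, summatory (fun n => (Ω n / log (log X)) ^ k) X
      ≤ X + C * (X / log (log X)) := by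
  obtain ⟨C, hC0, hC⟩ := exists_sum_cardFactors_add_pow_le k
  obtain ⟨B, hB0, hB⟩ := isBigO_primeRecipSum_floor_sub_log_log.exists_nonneg
  refine ⟨(1 + (B + C)) ^ k - 1, ?_⟩
  filter_upwards [hB.bound, tendsto_log_log_atTop.eventually_ge_atTop 1, eventually_ge_atTop 0]
    with X hX hL hX0
  rw [norm_one, mul_one, norm_eq_abs, abs_le] at hX
  set L := log (log X)
  have recip_nonneg := primeRecipSum_nonneg ⌊X⌋₊
  have moment_le := hC ⌊X⌋₊ 0
  simp only [Nat.cast_zero, add_zero] at moment_le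
  calc summatory (fun n => (Ω n / L) ^ k) X = (∑ n ∈ Icc 1 ⌊X⌋₊, (Ω n : ℝ) ^ k) / L ^ k := by
        simp only [summatory, div_pow, sum_div]
    _ ≤ ⌊X⌋₊ * (primeRecipSum ⌊X⌋₊ + C) ^ k / L ^ k := by gcongr
    _ ≤ X * (L + B + C) ^ k / L ^ k := by
        gcongr
        · exact Nat.floor_le hX0
        · linarith
    _ = X * (1 + L⁻¹ * (1 + (B + C) - 1)) ^ k := by
        rw [mul_div_assoc, ← div_pow]; congr 2; field_simp; ring
    _ ≤ X * (1 + L⁻¹ * ((1 + (B + C)) ^ k - 1)) := by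
        gcongr
        exact one_add_mul_sub_one_pow_le (by positivity) (inv_le_one_of_one_le₀ hL)
          (by positivity) k
    _ = _ := by ring

theorem exists_le_summatory_cardFactors_div_pow (k : ℕ) :
    ∃ C : ℝ, ∀ᶠ X in atTop, X - C * (X / log (log X))
      ≤ summatory (fun n => (Ω n / log (log X)) ^ k) X := by
  obtain ⟨B, hB0, hB⟩ := isBigO_primeRecipSum_floor_sub_log_log.exists_nonneg
  have log_log_le : ∀ᶠ X : ℝ in atTop, log (log X) ≤ X := by
    filter_upwards [eventually_ge_atTop 1] with X hX
    linarith [log_le_self (log_nonneg hX), log_le_self (zero_le_one.trans hX)]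
  refine ⟨1 + k * (B + 1), ?_⟩
  filter_upwards [hB.bound, tendsto_log_log_atTop.eventually_gt_atTop 0, eventually_ge_atTop 0,
    log_log_le] with X hX hL hX0 hLX
  rw [norm_one, mul_one, norm_eq_abs, abs_le] at hX
  set L := log (log X)
  have floor_le : (⌊X⌋₊ : ℝ) ≤ X := Nat.floor_le hX0
  have le_floor : X - X / L ≤ ⌊X⌋₊ := by
    linarith [(one_le_div hL).mpr hLX, Nat.sub_one_lt_floor X]
  have mean_ge := mul_primeRecipSum_sub_le_sum_cardFactors ⌊X⌋₊
  calc X - (1 + k * (B + 1)) * (X / L)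
      = X - X / L - k * (X * (B + 1) / L) := by ring
    _ ≤ ⌊X⌋₊ - k * (⌊X⌋₊ * (B + 1) / L) := by gcongr
    _ = ⌊X⌋₊ + k * ((⌊X⌋₊ * (L - B) - ⌊X⌋₊) / L - ⌊X⌋₊) := by field_simp; ring
    _ ≤ ⌊X⌋₊ + k * ((⌊X⌋₊ * primeRecipSum ⌊X⌋₊ - ⌊X⌋₊) / L - ⌊X⌋₊) := by
        gcongr
        linarith
    _ ≤ ⌊X⌋₊ + k * ((∑ n ∈ Icc 1 ⌊X⌋₊, (Ω n : ℝ)) / L - ⌊X⌋₊) := by gcongr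
    _ = ∑ n ∈ Icc 1 ⌊X⌋₊, (1 + k * (Ω n / L - 1)) := by
        simp [sum_add_distrib, ← mul_sum, sum_div]
    _ ≤ ∑ n ∈ Icc 1 ⌊X⌋₊, (Ω n / L) ^ k := by
        gcongr with n
        have ratio_nonneg : 0 ≤ Ω n / L := by positivity
        simpa using one_add_mul_le_pow (a := Ω n / L - 1) (by linarith) k

theorem isBigO_summatory_cardFactors_div_pow_sub (k : ℕ) :
    (fun X => summatory (fun n => (Ω n / log (log X)) ^ k) X - X)
      =O[atTop] fun X => X / log (log X) := by
  obtain ⟨C, hC⟩ := exists_summatory_cardFactors_div_pow_le k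
  obtain ⟨D, hD⟩ := exists_le_summatory_cardFactors_div_pow k
  refine .of_bound (max C D) ?_
  filter_upwards [hC, hD, tendsto_log_log_atTop.eventually_gt_atTop 0, eventually_ge_atTop 0]
    with X upper lower hL hX0
  have error_nonneg : 0 ≤ X / log (log X) := by positivity
  rw [norm_eq_abs, norm_of_nonneg error_nonneg, abs_le]
  have := mul_le_mul_of_nonneg_right (le_max_left C D) error_nonneg
  have := mul_le_mul_of_nonneg_right (le_max_right C D) error_nonneg
  constructor <;> linarith

/-! ### Tangent bounds for normalized iterated logarithms -/

/-- On `[0, ∞)` the function `g` is nonnegative, lies below the line of slope `c ∈ [0, 1]` through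
`(1, 1)`, and above that line minus `K * (t - 1) ^ 2`. In a family of functions, such as
`t ↦ log_j^+ (L t) / log_j^+ L` for varying `L`, the slope may vary while `K` stays fixed. -/
structure HasTangentBounds (g : ℝ → ℝ) (c K : ℝ) : Prop where
  slope_nonneg : 0 ≤ c
  slope_le_one : c ≤ 1
  nonneg {t : ℝ} : 0 ≤ t → 0 ≤ g t
  le_tangent {t : ℝ} : 0 ≤ t → g t ≤ 1 + c * (t - 1)
  tangent_sub_le {t : ℝ} : 0 ≤ t → 1 + c * (t - 1) - K * (t - 1) ^ 2 ≤ g t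

theorem tangent_sub_le_of_log_le {d u y : ℝ} (hd : 0 ≤ d) (hy : 0 ≤ y)
    (hlog : 0 < u → 1 + d * log u ≤ y) :
    1 + d * (u - 1) - (4 + 2 * d) * (u - 1) ^ 2 ≤ y := by
  rcases lt_or_ge u (1 / 2) with hu2 | hu2
  · nlinarith [mul_nonneg hd (sq_nonneg (u - 1))]
  · have hu0 : 0 < u := by linarith
    have log_ge : u - 1 - 2 * (u - 1) ^ 2 ≤ log u := by
      have inv_le : u⁻¹ ≤ 1 - (u - 1) + 2 * (u - 1) ^ 2 := by
        rw [inv_le_iff_one_le_mul₀ hu0]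
        nlinarith [mul_nonneg (sq_nonneg (u - 1)) (sub_nonneg.mpr hu2)]
      linarith [one_sub_inv_le_log_of_pos hu0]
    nlinarith [hlog hu0, mul_le_mul_of_nonneg_left log_ge hd, sq_nonneg (u - 1)]

theorem tangent_sub_le_rpow {α u : ℝ} (hα : 0 ≤ α) (hu : 0 ≤ u) :
    1 + α * (u - 1) - (4 + 2 * α) * (u - 1) ^ 2 ≤ u ^ α := by
  refine tangent_sub_le_of_log_le hα (rpow_nonneg hu α) fun hu0 => ?_
  rw [rpow_def_of_pos hu0]
  linarith [add_one_le_exp (log u * α)]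

theorem hasTangentBounds_posLog_mul_div {h : ℝ} (hh : exp 1 ≤ h) :
    HasTangentBounds (fun u => posLog (h * u) / log h) (log h)⁻¹ 6 := by
  have h_pos : 0 < h := (exp_pos 1).trans_le hh
  have one_le_log : 1 ≤ log h := (le_log_iff_exp_le h_pos).mpr hh
  have log_pos : 0 < log h := by linarith
  have slope_le_one : (log h)⁻¹ ≤ 1 := inv_le_one_of_one_le₀ one_le_log
  have nonneg (u : ℝ) : 0 ≤ posLog (h * u) / log h := div_nonneg posLog_nonneg log_pos.le
  refine ⟨by positivity, slope_le_one, fun _ => nonneg _, fun {u} hu => ?_, fun {u} _ => ?_⟩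
  · have posLog_le : posLog (h * u) ≤ log h + (u - 1) := by
      rcases hu.eq_or_lt with rfl | hu0
      · simpa [posLog_def] using one_le_log
      · rw [posLog_apply, log_mul h_pos.ne' hu0.ne']
        exact max_le (by linarith) (by linarith [log_le_sub_one_of_pos hu0])
    calc posLog (h * u) / log h ≤ (log h + (u - 1)) / log h := by gcongr
      _ = 1 + (log h)⁻¹ * (u - 1) := by field_simp
  · have log_le (hu0 : 0 < u) : 1 + (log h)⁻¹ * log u ≤ posLog (h * u) / log h := by
      calc 1 + (log h)⁻¹ * log u = log (h * u) / log h := by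
            rw [log_mul h_pos.ne' hu0.ne']; field_simp
        _ ≤ posLog (h * u) / log h := by gcongr; exact le_max_right _ _
    have tangent_sub_le := tangent_sub_le_of_log_le (by positivity) (nonneg u) log_le
    nlinarith [sq_nonneg (u - 1)]

namespace HasTangentBounds

variable {g φ : ℝ → ℝ} {c d K M t α : ℝ}

theorem id : HasTangentBounds (fun t => t) 1 0 := by
  constructor <;> simp

theorem error_nonneg (hg : HasTangentBounds g c K) : 0 ≤ K := by
  linarith [hg.le_tangent le_rfl, hg.tangent_sub_le le_rfl]

theorem sub_one_sq_le (hg : HasTangentBounds g c K) (ht : 0 ≤ t) :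
    (g t - 1) ^ 2 ≤ (1 + K) ^ 2 * (t - 1) ^ 2 := by
  have hK := hg.error_nonneg
  have abs_mul_le : |c * (t - 1)| ≤ |t - 1| := by
    rw [abs_mul, abs_of_nonneg hg.slope_nonneg]
    exact mul_le_of_le_one_left (abs_nonneg _) hg.slope_le_one
  rw [abs_le] at abs_mul_le
  have K_mul_nonneg : 0 ≤ K * |t - 1| := by positivity
  have upper : g t - 1 ≤ (1 + K) * |t - 1| := by linarith [hg.le_tangent ht]
  have lower : -((1 + K) * |t - 1|) ≤ g t - 1 := by
    rcases le_or_gt |t - 1| 1 with h | h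
    · have sq_le : (t - 1) ^ 2 ≤ |t - 1| := by
        rw [← sq_abs]; exact pow_le_of_le_one (abs_nonneg _) h two_ne_zero
      linarith [hg.tangent_sub_le ht, mul_le_mul_of_nonneg_left sq_le hK]
    · linarith [hg.nonneg ht]
  rw [← sq_abs (t - 1), ← mul_pow]
  exact sq_le_sq' lower upper

theorem tangent_sub_le_comp (hg : HasTangentBounds g c K) (hd : 0 ≤ d) (hM : 0 ≤ M)
    (hφ : ∀ u, 0 ≤ u → 1 + d * (u - 1) - M * (u - 1) ^ 2 ≤ φ u) (ht : 0 ≤ t) :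
    1 + d * c * (t - 1) - (d * K + M * (1 + K) ^ 2) * (t - 1) ^ 2 ≤ φ (g t) := by
  refine le_trans ?_ (hφ (g t) (hg.nonneg ht))
  linarith [mul_le_mul_of_nonneg_left (hg.tangent_sub_le ht) hd,
    mul_le_mul_of_nonneg_left (hg.sub_one_sq_le ht) hM]

theorem comp (hφ : HasTangentBounds φ d M) (hg : HasTangentBounds g c K) :
    HasTangentBounds (fun t => φ (g t)) (d * c) (K + M * (1 + K) ^ 2) where
  slope_nonneg := mul_nonneg hφ.slope_nonneg hg.slope_nonneg
  slope_le_one := mul_le_one₀ hφ.slope_le_one hg.slope_nonneg hg.slope_le_one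
  nonneg ht := hφ.nonneg (hg.nonneg ht)
  le_tangent ht := by
    linarith [hφ.le_tangent (hg.nonneg ht),
      mul_le_mul_of_nonneg_left (hg.le_tangent ht) hφ.slope_nonneg]
  tangent_sub_le {t} ht := by
    have lower := hg.tangent_sub_le_comp hφ.slope_nonneg hφ.error_nonneg
      (fun _ => hφ.tangent_sub_le) ht
    have dK_le : d * K ≤ K := mul_le_of_le_one_left hg.error_nonneg hφ.slope_le_one
    linarith [mul_le_mul_of_nonneg_right dK_le (sq_nonneg (t - 1))]

theorem rpow_le (hg : HasTangentBounds g c K) {m : ℕ} (hm : m ≠ 0) (hα : 0 ≤ α)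
    (hαm : α ≤ m) (ht : 0 ≤ t) : g t ^ α ≤ 1 + α / m * c * (t ^ m - 1) := by
  have hm0 : (0 : ℝ) < m := by positivity
  have pow_nonneg : 0 ≤ g t ^ m := pow_nonneg (hg.nonneg ht) m
  have pow_le : g t ^ m ≤ 1 + c * (t ^ m - 1) :=
    (pow_le_pow_left₀ (hg.nonneg ht) (hg.le_tangent ht) m).trans
      (one_add_mul_sub_one_pow_le hg.slope_nonneg hg.slope_le_one ht m)
  calc g t ^ α = (1 + (g t ^ m - 1)) ^ (α / m) := by
        rw [add_sub_cancel, ← rpow_natCast_mul (hg.nonneg ht), mul_div_cancel₀ α hm0.ne']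
    _ ≤ 1 + α / m * (g t ^ m - 1) :=
        rpow_one_add_le_one_add_mul_self (by linarith) (by positivity) ((div_le_one hm0).mpr hαm)
    _ ≤ 1 + α / m * (c * (t ^ m - 1)) := by
        gcongr
        linarith
    _ = _ := by ring

theorem tangent_sub_le_rpow (hg : HasTangentBounds g c K) (hα : 0 ≤ α) (ht : 0 ≤ t) :
    1 + α * c * (t - 1) - (α * K + (4 + 2 * α) * (1 + K) ^ 2) * (t - 1) ^ 2 ≤ g t ^ α :=
  hg.tangent_sub_le_comp (φ := (· ^ α)) hα (by positivity)
    (fun _ => _root_.tangent_sub_le_rpow hα) ht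

theorem sum_rpow_sub_le {ι : Type*} {s : Finset ι} {x : ι → ℝ} (hg : HasTangentBounds g c K)
    {m : ℕ} (hm : m ≠ 0) (hα : 0 ≤ α) (hαm : α ≤ m) (hx : ∀ i ∈ s, 0 ≤ x i) (X : ℝ) :
    ∑ i ∈ s, g (x i) ^ α - X
      ≤ (1 - α / m * c) * (∑ i ∈ s, x i ^ 0 - X) + α / m * c * (∑ i ∈ s, x i ^ m - X) := by
  have sum_le := sum_le_sum fun i hi => hg.rpow_le hm hα hαm (hx i hi)
  simp only [sum_add_distrib, ← mul_sum, sum_sub_distrib, pow_zero] at sum_le ⊢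
  linarith

theorem le_sum_rpow_sub {ι : Type*} {s : Finset ι} {x : ι → ℝ} (hg : HasTangentBounds g c K)
    (hα : 0 ≤ α) (hx : ∀ i ∈ s, 0 ≤ x i) {K' : ℝ}
    (hK' : K' = α * K + (4 + 2 * α) * (1 + K) ^ 2) (X : ℝ) :
    (1 - α * c - K') * (∑ i ∈ s, x i ^ 0 - X) + (α * c + 2 * K') * (∑ i ∈ s, x i ^ 1 - X)
      - K' * (∑ i ∈ s, x i ^ 2 - X) ≤ ∑ i ∈ s, g (x i) ^ α - X := by
  have sum_ge := sum_le_sum fun i hi => hg.tangent_sub_le_rpow hα (hx i hi)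
  simp only [← hK', sub_sq, one_pow, mul_one, sum_add_distrib, ← mul_sum, sum_sub_distrib,
    pow_zero, pow_one] at sum_ge ⊢
  linarith

theorem abs_sum_rpow_sub_le {ι : Type*} {s : Finset ι} {x : ι → ℝ} (hg : HasTangentBounds g c K)
    {m : ℕ} (hm : m ≠ 0) (hα : 0 ≤ α) (hαm : α ≤ m) (hx : ∀ i ∈ s, 0 ≤ x i) (X : ℝ) :
    |∑ i ∈ s, g (x i) ^ α - X| ≤ (1 + α + 2 * (α * K + (4 + 2 * α) * (1 + K) ^ 2))
      * (|∑ i ∈ s, x i ^ 0 - X| + |∑ i ∈ s, x i ^ 1 - X| + |∑ i ∈ s, x i ^ 2 - X|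
        + |∑ i ∈ s, x i ^ m - X|) := by
  obtain ⟨K', hK'⟩ : ∃ K', K' = α * K + (4 + 2 * α) * (1 + K) ^ 2 := ⟨_, rfl⟩
  rw [← hK']
  have K'_nonneg : 0 ≤ K' := by have := hg.error_nonneg; rw [hK']; positivity
  have ratio_nonneg : 0 ≤ α / m * c := mul_nonneg (by positivity) hg.slope_nonneg
  have ratio_le_one : α / m * c ≤ 1 :=
    mul_le_one₀ ((div_le_one (by positivity)).mpr hαm) hg.slope_nonneg hg.slope_le_one
  have slope_nonneg : 0 ≤ α * c := mul_nonneg hα hg.slope_nonneg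
  have slope_le : α * c ≤ α := mul_le_of_le_one_right hα hg.slope_le_one
  have term_bounds {y : ℝ} (k : ℕ) (hy : |y| ≤ 1 + α + 2 * K') :
      -((1 + α + 2 * K') * |∑ i ∈ s, x i ^ k - X|) ≤ y * (∑ i ∈ s, x i ^ k - X) ∧
        y * (∑ i ∈ s, x i ^ k - X) ≤ (1 + α + 2 * K') * |∑ i ∈ s, x i ^ k - X| := by
    rw [← abs_le, abs_mul]
    gcongr
  have error_nonneg (k : ℕ) : 0 ≤ (1 + α + 2 * K') * |∑ i ∈ s, x i ^ k - X| := by positivity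
  have upper := hg.sum_rpow_sub_le hm hα hαm hx X
  have lower := hg.le_sum_rpow_sub hα hx hK' X
  rw [abs_le]
  constructor
  · have zeroth : |1 - α * c - K'| ≤ 1 + α + 2 * K' := abs_le.mpr ⟨by linarith, by linarith⟩
    have first : |α * c + 2 * K'| ≤ 1 + α + 2 * K' := abs_le.mpr ⟨by linarith, by linarith⟩
    have second : |K'| ≤ 1 + α + 2 * K' := abs_le.mpr ⟨by linarith, by linarith⟩
    linarith [(term_bounds 0 zeroth).1, (term_bounds 1 first).1, (term_bounds 2 second).2,
      error_nonneg m]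
  · have zeroth : |1 - α / m * c| ≤ 1 + α + 2 * K' := abs_le.mpr ⟨by linarith, by linarith⟩
    have mth : |α / m * c| ≤ 1 + α + 2 * K' := abs_le.mpr ⟨by linarith, by linarith⟩
    linarith [(term_bounds 0 zeroth).2, (term_bounds m mth).2, error_nonneg 1, error_nonneg 2]

end HasTangentBounds

/-! ### Average orders -/

theorem summatory_mono {f g : ℕ → ℝ} (hfg : f ≤ g) : summatory f ≤ summatory g :=
  fun _ => sum_le_sum fun n _ => hfg n

theorem summatory_nonneg {f : ℕ → ℝ} (hf : 0 ≤ f) : 0 ≤ summatory f :=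
  fun _ => sum_nonneg fun n _ => hf n

theorem HasAverageOrder.of_isEquivalent {f : ℕ → ℝ} {g : ℝ → ℝ}
    (h : summatory f ~[atTop] fun X => X * g X) : HasAverageOrder f g := by
  refine ((isTheta_refl (fun X : ℝ => 1 / X) atTop).mul h.isTheta).trans_eventuallyEq ?_
  filter_upwards [eventually_ne_atTop 0] with X hX
  field_simp

theorem HasAverageOrder.of_le_of_le_mul_one_add {f f' : ℕ → ℝ} {g : ℝ → ℝ} {C : ℝ}
    (hf : HasAverageOrder f g) (hg : (fun _ : ℝ => (1 : ℝ)) =O[atTop] g) (hf0 : 0 ≤ f)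
    (hle : f ≤ f') (hle' : ∀ n, f' n ≤ C * (1 + f n)) : HasAverageOrder f' g := by
  have mean_nonneg {X : ℝ} (hX : 0 < X) : 0 ≤ 1 / X * summatory f X :=
    mul_nonneg (by positivity) (summatory_nonneg hf0 X)
  have mean_le {X : ℝ} (hX : 0 < X) : 1 / X * summatory f X ≤ 1 / X * summatory f' X := by
    gcongr
    exact summatory_mono hle X
  constructor
  · have hC : 0 ≤ C := nonneg_of_mul_nonneg_left (((hf0 0).trans (hle 0)).trans (hle' 0))
      (add_pos_of_pos_of_nonneg one_pos (hf0 0))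
    refine IsBigO.trans (.of_bound C ?_) (hg.add hf.1)
    filter_upwards [eventually_gt_atTop 0] with X hX
    rw [norm_of_nonneg ((mean_nonneg hX).trans (mean_le hX)),
      norm_of_nonneg (add_nonneg zero_le_one (mean_nonneg hX))]
    calc 1 / X * summatory f' X ≤ 1 / X * summatory (fun n => C * (1 + f n)) X := by
          gcongr
          exact summatory_mono hle' X
      _ = C * (⌊X⌋₊ / X + 1 / X * summatory f X) := by
          simp only [summatory, ← mul_sum, sum_add_distrib, sum_const, Nat.card_Icc,
            add_tsub_cancel_right, nsmul_one]
          ring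
      _ ≤ C * (1 + 1 / X * summatory f X) := by
          gcongr
          exact (div_le_one hX).mpr (Nat.floor_le hX.le)
  · refine hf.2.trans (.of_bound 1 ?_)
    filter_upwards [eventually_gt_atTop 0] with X hX
    rw [one_mul, norm_of_nonneg (mean_nonneg hX),
      norm_of_nonneg ((mean_nonneg hX).trans (mean_le hX))]
    exact mean_le hX

theorem one_add_rpow_le {α x : ℝ} (hα : 0 ≤ α) (hx : 0 ≤ x) :
    (1 + x) ^ α ≤ 2 ^ α * (1 + x ^ α) := by
  calc (1 + x) ^ α ≤ (2 * max 1 x) ^ α := by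
        gcongr
        linarith [le_max_left 1 x, le_max_right 1 x]
    _ = 2 ^ α * max 1 x ^ α := mul_rpow zero_le_two (zero_le_one.trans (le_max_left 1 x))
    _ ≤ 2 ^ α * (1 + x ^ α) := by
        gcongr
        rcases le_total 1 x with h | h
        · simp [h]
        · simpa [h] using rpow_nonneg hx α

/-! ### Iterated logarithms of `Ω` -/

theorem iterPosLog_nonneg (j : ℕ) {x : ℝ} (hx : 0 ≤ x) : 0 ≤ iterPosLog j x := by
  cases j with
  | zero => exact hx
  | succ j => exact posLog_nonneg

theorem tendsto_iterPosLog_atTop (j : ℕ) : Tendsto (iterPosLog j) atTop atTop := by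
  induction j with
  | zero => exact tendsto_id
  | succ j ih =>
    exact tendsto_atTop_mono (fun _ => le_max_right _ _) (tendsto_log_atTop.comp ih)

theorem iterPosLog_succ_eq_log {j : ℕ} {x : ℝ} (hx : 1 ≤ iterPosLog j x) :
    iterPosLog (j + 1) x = log (iterPosLog j x) :=
  posLog_eq_log (hx.trans (le_abs_self _))

theorem iterPosLog_eventuallyEq_iterLog (j : ℕ) : iterPosLog j =ᶠ[atTop] iterLog j := by
  induction j with
  | zero => rfl
  | succ j ih =>
    filter_upwards [ih, (tendsto_iterPosLog_atTop j).eventually_ge_atTop 1] with x hx one_le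
    rw [iterPosLog_succ_eq_log one_le, hx, iterLog, iterLog, Function.iterate_succ_apply']

theorem exists_hasTangentBounds_iterPosLog_div (j : ℕ) :
    ∃ K : ℝ, ∀ᶠ L in atTop,
      ∃ c, HasTangentBounds (fun t => iterPosLog j (L * t) / iterPosLog j L) c K := by
  induction j with
  | zero =>
    refine ⟨0, ?_⟩
    filter_upwards [eventually_gt_atTop 0] with L hL
    refine ⟨1, ?_⟩
    simpa only [iterPosLog, mul_div_cancel_left₀ _ hL.ne'] using HasTangentBounds.id
  | succ j ih =>
    obtain ⟨K, hK⟩ := ih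
    refine ⟨K + 6 * (1 + K) ^ 2, ?_⟩
    filter_upwards [hK, (tendsto_iterPosLog_atTop j).eventually_ge_atTop (exp 1)]
      with L ⟨c, hc⟩ exp_one_le
    have pos : 0 < iterPosLog j L := (exp_pos 1).trans_le exp_one_le
    have one_le : 1 ≤ iterPosLog j L := (one_le_exp zero_le_one).trans exp_one_le
    have bounds := (hasTangentBounds_posLog_mul_div exp_one_le).comp hc
    simp only [mul_div_cancel₀ _ pos.ne', ← iterPosLog_succ_eq_log one_le] at bounds
    exact ⟨_, bounds⟩

theorem isBigO_summatory_iterPosLogOmega_div_rpow_sub (j : ℕ) {α : ℝ} (hα : 0 ≤ α) :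
    (fun X => summatory (fun n => (iterPosLogOmega j n / iterPosLog j (log (log X))) ^ α) X - X)
      =O[atTop] fun X => X / log (log X) := by
  obtain ⟨K, hK⟩ := exists_hasTangentBounds_iterPosLog_div j
  have moment (k : ℕ) := (isBigO_summatory_cardFactors_div_pow_sub k).norm_left
  let m := ⌈α⌉₊ + 1
  refine IsBigO.trans (.of_bound (1 + α + 2 * (α * K + (4 + 2 * α) * (1 + K) ^ 2)) ?_)
    (((moment 0).add (moment 1)).add (moment 2) |>.add (moment m))
  filter_upwards [tendsto_log_log_atTop.eventually hK, tendsto_log_log_atTop.eventually_gt_atTop 0]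
    with X ⟨c, hc⟩ hL
  have bound := hc.abs_sum_rpow_sub_le (s := Icc 1 ⌊X⌋₊) (x := fun n => Ω n / log (log X))
    (m := m) (by lia) hα ((Nat.le_ceil α).trans (by simp [m])) (fun n _ => by positivity) X
  simp only [mul_div_cancel₀ _ hL.ne'] at bound
  refine bound.trans_eq ?_
  rw [norm_of_nonneg (by positivity)]
  rfl

theorem isBigO_summatory_iterPosLogOmega_rpow_sub (j : ℕ) {α : ℝ} (hα : 0 ≤ α) :
    (fun X : ℝ => summatory (fun n => iterPosLogOmega j n ^ α) X - X * iterLog (j + 2) X ^ α)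
      =O[atTop] fun X : ℝ => X * iterLog (j + 2) X ^ α / iterLog 2 X := by
  have normalized := (isBigO_refl (fun X => iterPosLog j (log (log X)) ^ α) atTop).mul
    (isBigO_summatory_iterPosLogOmega_div_rpow_sub j hα)
  have iterLog_eq : ∀ᶠ X in atTop, iterPosLog j (log (log X)) = iterLog (j + 2) X :=
    tendsto_log_log_atTop.eventually (iterPosLog_eventuallyEq_iterLog j)
  have scale_pos : ∀ᶠ X in atTop, 0 < iterPosLog j (log (log X)) :=
    ((tendsto_iterPosLog_atTop j).comp tendsto_log_log_atTop).eventually_gt_atTop 0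
  refine normalized.congr' ?_ ?_
  · filter_upwards [iterLog_eq, scale_pos] with X hX hpos
    have div_rpow_eq (n : ℕ) : (iterPosLogOmega j n / iterPosLog j (log (log X))) ^ α
        = iterPosLogOmega j n ^ α / iterPosLog j (log (log X)) ^ α :=
      div_rpow (iterPosLog_nonneg j (Nat.cast_nonneg _)) hpos.le α
    simp only [summatory, div_rpow_eq, ← sum_div, ← hX]
    rw [mul_sub, mul_div_cancel₀ _ (rpow_pos_of_pos hpos α).ne', mul_comm X]
  · filter_upwards [iterLog_eq] with X hX
    rw [hX, show iterLog 2 X = log (log X) from rfl]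
    ring

theorem isEquivalent_summatory_iterPosLogOmega_rpow (j : ℕ) {α : ℝ} (hα : 0 ≤ α) :
    summatory (fun n => iterPosLogOmega j n ^ α)
      ~[atTop] fun X => X * iterPosLog (j + 2) X ^ α := by
  have inv_tendsto : (fun X : ℝ => (log (log X))⁻¹) =o[atTop] fun _ => (1 : ℝ) :=
    (isLittleO_one_iff ℝ).mpr tendsto_log_log_atTop.inv_tendsto_atTop
  have error_isLittleO : (fun X => X * iterLog (j + 2) X ^ α / log (log X))
      =o[atTop] fun X => X * iterLog (j + 2) X ^ α := by
    simpa only [mul_one, ← div_eq_mul_inv] using (isBigO_refl _ _).mul_isLittleO inv_tendsto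
  refine (isBigO_summatory_iterPosLogOmega_rpow_sub j hα).trans_isLittleO error_isLittleO
    |>.isEquivalent.trans (EventuallyEq.isEquivalent ?_)
  filter_upwards [iterPosLog_eventuallyEq_iterLog (j + 2)] with X hX
  rw [hX]

theorem mainTheorem3 (j : ℕ) (α : ℝ) (hα : 0 < α) :
    ((fun X : ℝ => summatory (fun n => iterPosLogOmega j n ^ α) X - X * iterLog (j + 2) X ^ α)
      =O[atTop] fun X : ℝ => X * iterLog (j + 2) X ^ α / iterLog 2 X) ∧
    HasAverageOrder (fun n => iterPosLogOmega j n ^ α) (fun X => iterPosLog (j + 2) X ^ α) ∧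
    HasAverageOrder (logWeight j α) (fun X => iterPosLog (j + 2) X ^ α) := by
  have nonneg (n : ℕ) : 0 ≤ iterPosLogOmega j n := iterPosLog_nonneg j (Nat.cast_nonneg _)
  have averageOrder : HasAverageOrder (fun n => iterPosLogOmega j n ^ α)
      fun X => iterPosLog (j + 2) X ^ α :=
    .of_isEquivalent (isEquivalent_summatory_iterPosLogOmega_rpow j hα.le)
  have one_isBigO : (fun _ : ℝ => (1 : ℝ)) =O[atTop] fun X => iterPosLog (j + 2) X ^ α :=
    ((isLittleO_one_left_iff ℝ).mpr (tendsto_norm_atTop_atTop.comp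
      ((tendsto_rpow_atTop hα).comp (tendsto_iterPosLog_atTop (j + 2))))).isBigO
  refine ⟨isBigO_summatory_iterPosLogOmega_rpow_sub j hα.le, averageOrder,
    averageOrder.of_le_of_le_mul_one_add one_isBigO (fun n => rpow_nonneg (nonneg n) α)
      (fun n => ?_) fun n => one_add_rpow_le hα.le (nonneg n)⟩
  exact rpow_le_rpow (nonneg n) (le_add_of_nonneg_left zero_le_one) hα.le
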